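/- Let $\Phi$ be the (reduced, irreducible, crystallographic) root system of a finite-dimensional simple complex Lie algebra, with simple roots $\alpha_i$ and simple coroots $\alpha_i^\vee$, $i\in I$, the nodes of the Dynkin diagram being labelled $1,\dots,n$ as in Bourbaki. For $J\subseteq I$ let $\Phi_J$ be the root system generated by $\{\alpha_j : j\in J\}$, with Weyl group $W_J=\langle s_j : j\in J\rangle$. For $i\in J$ let $\omega_i^J$ be the corresponding fundamental weight of $\Phi_J$, that is, the vector in the span of $\{\alpha_j: j\in J\}$ with $\langle\alpha_j^\vee,\omega_i^J\rangle=\delta_{ij}$ for $j\in J$. The node $i\in J$ is called *braidless* for $\Phi_J$ if for every $\tau\in W_J$ and all $j\neq l$ in $J$: if $\langle\alpha_j^\vee,\tau\omega_i^J\rangle>0$ and $\langle\alpha_l^\vee,\tau\omega_i^J\rangle>0$, then $\langle\alpha_j^\vee,\alpha_l\rangle=0$. An enumeration $i_1,\dots,i_n$ of $I$ is *good* if, for each $k$, the node $i_k$ is braidless for $\Phi_{\{i_k,\dots,i_n\}}$. **Proposition 4.9.** The good enumerations are exactly the following. 1. Type $A_n$ ($n\ge 1$): every enumeration is good. 2.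 Type $B_n$ or $C_n$ ($n\ge2$): an enumeration is good if and only if it is of the form $1,2,\dots,k,n,\dots$ for some $0\le k\le n-1$, where everything after $n$ is arbitrary ($k=0$ means that $n$ comes first). 3. Type $D_n$ ($n\ge3$, where $D_3$ is $A_3$ with node $1$ in the middle): an enumeration is good if and only if it is of the form $1,2,\dots,k,x,\dots$ for some $k\ge 0$ and some $x\in\{n-1,n\}$, where everything after $x$ is arbitrary. 4. Type $E_6$ (the trivalent node is $4$, its three branches are $2$; $3,1$; and $5,6$): an enumeration is good if and only if either $i_1=1$ and $i_2,\dots,i_6$ satisfies the $D_5$ rule of (3) for the remaining diagram, whose nodes in the order of the $D_5$ labels $1,\dots,5$ are $6,5,4,3,2$; or $i_1=6$ and $i_2,\dots,i_6$ satisfies the $D_5$ rule for the remaining diagram, whose nodes in the order of the $D_5$ labels are $1,3,4,2,5$. (The nodes $1$ and $6$ are the two nodes farthest from the trivalent node.) 5. Type $E_7$: an enumeration is good if and only if $i_1=7$ (the node farthest from the trivalent node) and $i_2,\dots,i_7$ satisfies the $E_6$ rule of (4) on the nodes $1,\dots,6$. 6. Types $E_8$ and $F_4$: there are no good enumerations.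 7. Type $G_2$: both enumerations are good. -/

import Mathlib

namespace GoodEnumeration

open Submodule

variable {ι K M N : Type*} [Field K] [AddCommGroup M] [Module K M] [AddCommGroup N] [Module K N]

/-- For a set `J` of indices of simple roots, the root system generated by the roots `α_j`, `j ∈ J`,
lives in the span of these roots and has them as its simple roots. Its Weyl group is generated by
the reflections `s_j`, `j ∈ J`. -/
def weylGroup (P : RootPairing ι K M N) (J : Set ι) : Subgroup (M ≃ₗ[K] M) :=
  Subgroup.closure (P.reflection '' J)

/-- `ω` is the fundamental weight `ω_i` of the root system generated by the simple roots `α_j`,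
`j ∈ J`: it lies in the span of these roots and `⟨α_j^∨, ω⟩ = δ_ij` for all `j ∈ J`.
By `existsUnique_isFundamentalWeight` there is exactly one such vector. -/
def IsFundamentalWeight (P : RootPairing ι K M N) (J : Set ι) (i : ι) (ω : M) : Prop :=
  ω ∈ span K (P.root '' J) ∧ P.coroot' i ω = 1 ∧ ∀ j ∈ J, j ≠ i → P.coroot' j ω = 0

/-- The scalar `c` is a positive integer. The pairings `⟨α^∨, τ ω_i⟩` with `τ` in the Weyl group are
integers, so this is the meaning of `⟨α^∨, τ ω_i⟩ > 0` over any field of characteristic zero, for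
example over the complex numbers. -/
def IsPosInteger (c : K) : Prop :=
  ∃ m : ℕ, 0 < m ∧ c = (m : K)

/-- The node `i` is braidless for the root system generated by the simple roots `α_j`, `j ∈ J`:
no weight in the Weyl group orbit of the fundamental weight `ω_i` has positive pairings with the
coroots of two distinct simple roots that are not orthogonal. -/
def IsBraidless (P : RootPairing ι K M N) (J : Set ι) (i : ι) : Prop :=
  ∀ ω : M, IsFundamentalWeight P J i ω → ∀ τ ∈ weylGroup P J, ∀ j ∈ J, ∀ l ∈ J, j ≠ l →
    IsPosInteger (P.coroot' j (τ ω)) → IsPosInteger (P.coroot' l (τ ω)) → P.pairing l j = 0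

/-- The enumeration `s 0, s 1, …, s (n - 1)` of the simple roots is good if each `s k` is braidless
for the root system generated by the simple roots `s k, …, s (n - 1)`. -/
def IsGood {P : RootPairing ι K M N} {b : P.Base} {n : ℕ} (s : Fin n ≃ b.support) : Prop :=
  ∀ k : Fin n, IsBraidless P {i | ∃ m : Fin n, k ≤ m ∧ (s m : ι) = i} (s k)

/-- `e` labels the nodes of the Dynkin diagram in such a way that the Cartan matrix becomes `A`.
Here `b.cartanMatrix i j` is `⟨α_i, α_j^∨⟩`; with this convention Mathlib's matrices `CartanMatrix.A`,
`B`, `C`, `D`, `E₆`, `E₇`, `E₈`, `F₄` are those of Bourbaki, and `CartanMatrix.G₂` is Bourbaki's with the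
two nodes interchanged. -/
def HasType {P : RootPairing ι K M N} [CharZero K] [P.IsCrystallographic] {b : P.Base} {n : ℕ}
    (e : Fin n ≃ b.support) (A : Matrix (Fin n) (Fin n) ℤ) : Prop :=
  ∀ i j : Fin n, b.cartanMatrix (e i) (e j) = A i j

/-! ### The rules

Below, `node m` is the node with Bourbaki label `m + 1`, and `s` is a sequence of nodes. -/

/-- `1 < 2 < ⋯ < k < n < ⋯` for some `k ≥ 0`, everything after `n` being arbitrary. -/
def RuleBC {I : Type*} {n : ℕ} (node s : Fin n → I) : Prop :=
  ∃ k x : Fin n, (x : ℕ) + 1 = n ∧ (∀ m < k, s m = node m) ∧ s k = node x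

/-- `1 < 2 < ⋯ < k < x < ⋯` for some `k ≥ 0` and `x = n - 1` or `x = n`, everything after `x` being
arbitrary. -/
def RuleD {I : Type*} {n : ℕ} (node s : Fin n → I) : Prop :=
  ∃ k x : Fin n, ((x : ℕ) + 2 = n ∨ (x : ℕ) + 1 = n) ∧ (∀ m < k, s m = node m) ∧ s k = node x

/-- Start with one of the two nodes `1`, `6` farthest from the trivalent node `4`, and continue by the
`D₅` rule. The diagram without `1` is `D₅` with nodes `6, 5, 4, 3, 2` in Bourbaki order, the
diagram without `6` is `D₅` with nodes `1, 3, 4, 2, 5` in Bourbaki order. -/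
def RuleE₆ {I : Type*} (node s : Fin 6 → I) : Prop :=
  (s 0 = node 0 ∧ RuleD ![node 5, node 4, node 3, node 2, node 1] (Fin.tail s)) ∨
  (s 0 = node 5 ∧ RuleD ![node 0, node 2, node 3, node 1, node 4] (Fin.tail s))

/-- Start with the node `7` farthest from the trivalent node `4`, and continue by the `E₆` rule on the
nodes `1, …, 6`. -/
def RuleE₇ {I : Type*} (node s : Fin 7 → I) : Prop :=
  s 0 = node 6 ∧ RuleE₆ (Fin.init node) (Fin.tail s)

/-! ### Fundamental weights of the generated root systems exist and are unique -/

theorem det_ne_zero [CharZero K] [Finite ι] {P : RootPairing ι K M N} [P.IsRootSystem]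
    [P.IsCrystallographic] (b : P.Base) {κ : Type*} [Fintype κ] [DecidableEq κ]
    (f : κ → b.support) (hf : Function.Injective f) :
    (Matrix.of fun i j : κ ↦ P.pairing (f i) (f j)).det ≠ 0 := by
  classical
  obtain ⟨d, -, hd⟩ := b.exists_cartanMatrix_diagaonal_mul_posDef
  have h1 : (b.cartanMatrix.submatrix f f).det ≠ 0 := by
    intro h0
    obtain ⟨v, hv, hv'⟩ := Matrix.exists_mulVec_eq_zero_iff.mpr h0
    have h2 := (hd.submatrix hf).dotProduct_mulVec_pos hv
    have h3 : (Matrix.diagonal d * b.cartanMatrix).submatrix f f =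
        Matrix.diagonal (d ∘ f) * b.cartanMatrix.submatrix f f := by
      ext i j
      simp
    rw [h3, ← Matrix.mulVec_mulVec, hv'] at h2
    simp at h2
  have h4 : (Matrix.of fun i j : κ ↦ P.pairing (f i) (f j)) =
      (Int.castRingHom K).mapMatrix (b.cartanMatrix.submatrix f f) := by
    ext i j
    simpa using (b.algebraMap_cartanMatrixIn_apply ℤ (f i) (f j)).symm
  rw [h4, ← RingHom.map_det]
  simpa using h1

theorem existsUnique_isFundamentalWeight [CharZero K] [Finite ι] {P : RootPairing ι K M N}
    [P.IsRootSystem] [P.IsCrystallographic] (b : P.Base) {J : Set ι} (hJ : J ⊆ b.support) {i : ι}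
    (hi : i ∈ J) : ∃! ω : M, IsFundamentalWeight P J i ω := by
  classical
  let _ : Fintype J := Fintype.ofFinite J
  let f : J → b.support := fun j ↦ ⟨j, hJ j.2⟩
  have hf : Function.Injective f := fun x y h ↦ Subtype.ext (congrArg (fun z : b.support ↦ (z : ι)) h)
  have hdet := det_ne_zero b f hf
  set C : Matrix J J K := Matrix.of fun i j : J ↦ P.pairing (f i) (f j) with hC
  have key (c : J → K) (j : J) :
      P.coroot' j (∑ l, c l • P.root l) = (Matrix.vecMul c C) j := by
    simp [Matrix.vecMul, dotProduct, hC, f]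
  have hspan (ω : M) : ω ∈ span K (P.root '' J) ↔ ∃ c : J → K, ∑ l, c l • P.root l = ω := by
    rw [Set.image_eq_range, mem_span_range_iff_exists_fun]
  have hchar (c : J → K) : IsFundamentalWeight P J i (∑ l, c l • P.root l) ↔
      Matrix.vecMul c C = Pi.single ⟨i, hi⟩ 1 := by
    constructor
    · rintro ⟨-, h1, h2⟩
      ext j
      rw [← key]
      by_cases hj : j = ⟨i, hi⟩
      · subst hj
        simpa using h1
      · rw [Pi.single_eq_of_ne hj]
        exact h2 j j.2 fun h ↦ hj (Subtype.ext h)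
    · intro h
      refine ⟨(hspan _).mpr ⟨c, rfl⟩, ?_, fun j hj hji ↦ ?_⟩
      · rw [key c ⟨i, hi⟩, h]
        simp
      · rw [key c ⟨j, hj⟩, h, Pi.single_eq_of_ne]
        exact fun h' ↦ hji (congrArg (fun z : J ↦ (z : ι)) h')
  have hu : IsUnit C := (Matrix.isUnit_iff_isUnit_det C).mpr (isUnit_iff_ne_zero.mpr hdet)
  obtain ⟨c, hc⟩ := (Matrix.vecMul_surjective_iff_isUnit.mpr hu) (Pi.single ⟨i, hi⟩ 1)
  refine ⟨∑ l, c l • P.root l, (hchar c).mpr hc, fun ω hω ↦ ?_⟩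
  obtain ⟨c', rfl⟩ := (hspan ω).mp hω.1
  have : c' = c := (Matrix.vecMul_injective_iff_isUnit.mpr hu) (((hchar c').mp hω).trans hc.symm)
  rw [this]

end GoodEnumeration

/-! Only the integers `⟨α_j^∨, τ ω_i⟩` matter, and a simple reflection changes them through the
Cartan matrix alone. So goodness is a property of that matrix (`isBraidless_iff`, `isGood_iff`).
Braidlessness is inherited by smaller sets of nodes (`IsBraidlessFor.mono`).

Minuscule weights are braidless: if two non-orthogonal simple coroots pair positively with a weight
of the orbit, the reflection of one in the other is a coroot pairing to at least 2. For a full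
irreducible diagram the only other braidless nodes are `1` in type B and `n` in type C, whose orbits
are proportional to minuscule orbits of the dual type, and the nodes of G₂. The proof checks all
this in coordinates: 0/1 sequences for paths, the vectors `± e_m` and the sign vectors in types B,
C, D, and listed orbits in types E₆, E₇, G₂. For each remaining node one explicit orbit element
violates the condition.

Enumerations are then treated by removing nodes. In types B, C, D the first node leaves a diagram of
the same kind, while a node at the far end leaves a path, on which nothing is forbidden; this is
`isGoodSeq_iff_exists_prefix`. E₇ has one possible start, leaving E₆; E₆ has two, each leaving D₅;
E₈ and F₄ have none. -/

namespace GoodEnumeration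

/-! ### Braidlessness in terms of a Cartan matrix -/

section Combinatorics

variable {κ : Type*}

/-- `WeightOrbit C J i v` says that `v`, a family of pairings with simple coroots of which only those
with index in `J` matter, is obtained from the pairings of the fundamental weight `ω_i` by a
sequence of the reflections `s_j`, `j ∈ J`. -/
inductive WeightOrbit (C : κ → κ → ℤ) (J : Set κ) (i : κ) : (κ → ℤ) → Prop
  | start (v : κ → ℤ) (h1 : v i = 1) (h0 : ∀ j ∈ J, j ≠ i → v j = 0) : WeightOrbit C J i v
  | reflect (v : κ → ℤ) (hv : WeightOrbit C J i v) (j : κ) (hj : j ∈ J) :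
      WeightOrbit C J i fun l ↦ v l - v j * C j l

/-- Braidlessness of a node, expressed by the Cartan matrix `C`. -/
def IsBraidlessFor (C : κ → κ → ℤ) (J : Set κ) (i : κ) : Prop :=
  ∀ v, WeightOrbit C J i v → ∀ j ∈ J, ∀ l ∈ J, j ≠ l → 0 < v j → 0 < v l → C l j = 0

/-- Goodness of a sequence of nodes, expressed by the Cartan matrix `C`. -/
def IsGoodSeq (C : κ → κ → ℤ) {n : ℕ} (s : Fin n → κ) : Prop :=
  ∀ k, IsBraidlessFor C {i | ∃ m, k ≤ m ∧ s m = i} (s k)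

/-- On `J'` the fundamental weights for `J` and `J'` have the same pairings, and the reflections in
`J'` act on these in the same way, so a word in the smaller Weyl group can be replayed in the larger
one. -/
theorem WeightOrbit.mono {C : κ → κ → ℤ} {J J' : Set κ} {i : κ} (h : J' ⊆ J) {v : κ → ℤ}
    (hv : WeightOrbit C J' i v) : ∃ w, WeightOrbit C J i w ∧ ∀ j ∈ J', w j = v j := by
  classical
  induction hv with
  | start v h1 h0 =>
    refine ⟨Pi.single i 1, .start _ (by simp) fun j _ hj ↦ by simp [hj], fun j hj ↦ ?_⟩
    by_cases hji : j = i
    · subst hji; simp [h1]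
    · simp [hji, h0 j hj hji]
  | reflect v _ j hj ih =>
    obtain ⟨w, hw, hwv⟩ := ih
    exact ⟨_, hw.reflect _ j (h hj), fun l hl ↦ by rw [hwv l hl, hwv j hj]⟩

theorem IsBraidlessFor.mono {C : κ → κ → ℤ} {J J' : Set κ} {i : κ} (h : J' ⊆ J)
    (hb : IsBraidlessFor C J i) : IsBraidlessFor C J' i := by
  intro v hv j hj l hl hjl hvj hvl
  obtain ⟨w, hw, hwv⟩ := hv.mono h
  exact hb w hw j (h hj) l (h hl) hjl (by rwa [hwv j hj]) (by rwa [hwv l hl])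

/-- Braidlessness from a model of the orbit: points `x` of `X` with coordinates `φ j x` and reflections
`ρ j`; the coordinates are the pairings multiplied by `d`. -/
theorem IsBraidlessFor.of_model {C : κ → κ → ℤ} {J : Set κ} {i : κ} {E : Type*} (φ : κ → E → ℤ)
    (ρ : κ → E → E) (X : Set E) (d : ℤ) (hd : 0 < d)
    (hρ : ∀ x ∈ X, ∀ j ∈ J, ρ j x ∈ X)
    (hφ : ∀ x ∈ X, ∀ j ∈ J, ∀ l ∈ J, φ l (ρ j x) = φ l x - φ j x * C j l)
    (x₀ : E) (hx₀ : x₀ ∈ X) (h1 : φ i x₀ = d) (h0 : ∀ j ∈ J, j ≠ i → φ j x₀ = 0)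
    (hX : ∀ x ∈ X, ∀ j ∈ J, ∀ l ∈ J, j ≠ l → 0 < φ j x → 0 < φ l x → C l j = 0) :
    IsBraidlessFor C J i := by
  have key (v) (hv : WeightOrbit C J i v) : ∃ x ∈ X, ∀ j ∈ J, φ j x = d * v j := by
    induction hv with
    | start v hv1 hv0 =>
      refine ⟨x₀, hx₀, fun j hj ↦ ?_⟩
      by_cases hji : j = i
      · subst hji; rw [h1, hv1, mul_one]
      · rw [h0 j hj hji, hv0 j hj hji, mul_zero]
    | reflect v _ j hj ih =>
      obtain ⟨x, hx, hxv⟩ := ih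
      refine ⟨ρ j x, hρ x hx j hj, fun l hl ↦ ?_⟩
      rw [hφ x hx j hj l hl, hxv l hl, hxv j hj]
      ring
  intro v hv j hj l hl hjl hvj hvl
  obtain ⟨x, hx, hxv⟩ := key v hv
  exact hX x hx j hj l hl hjl (hxv j hj ▸ mul_pos hd hvj) (hxv l hl ▸ mul_pos hd hvl)

/-- The point `x` of a model represents an element of the orbit of `ω_i`. -/
def IsReached (C : κ → κ → ℤ) (J : Set κ) (i : κ) {E : Type*} (φ : κ → E → ℤ) (x : E) : Prop :=
  ∃ v, WeightOrbit C J i v ∧ ∀ j ∈ J, v j = φ j x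

theorem IsReached.start {C : κ → κ → ℤ} {J : Set κ} {i : κ} {E : Type*} {φ : κ → E → ℤ} {x : E}
    (h1 : φ i x = 1) (h0 : ∀ j ∈ J, j ≠ i → φ j x = 0) : IsReached C J i φ x :=
  ⟨fun j ↦ φ j x, .start _ h1 h0, fun _ _ ↦ rfl⟩

theorem IsReached.reflect {C : κ → κ → ℤ} {J : Set κ} {i : κ} {E : Type*} {φ : κ → E → ℤ} {x y : E}
    (hx : IsReached C J i φ x) (j : κ) (hj : j ∈ J)
    (hφ : ∀ l ∈ J, φ l y = φ l x - φ j x * C j l) : IsReached C J i φ y := by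
  obtain ⟨v, hv, hvx⟩ := hx
  exact ⟨_, hv.reflect _ j hj, fun l hl ↦ by rw [hφ l hl, hvx l hl, hvx j hj]⟩

theorem IsReached.not_isBraidlessFor {C : κ → κ → ℤ} {J : Set κ} {i : κ} {E : Type*}
    {φ : κ → E → ℤ} {x : E} (hx : IsReached C J i φ x) {j l : κ} (hj : j ∈ J) (hl : l ∈ J)
    (hjl : j ≠ l) (hC : C l j ≠ 0) (hjx : 0 < φ j x) (hlx : 0 < φ l x) :
    ¬ IsBraidlessFor C J i := by
  obtain ⟨v, hv, hvx⟩ := hx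
  exact fun h ↦ hC (h v hv j hj l hl hjl (hvx j hj ▸ hjx) (hvx l hl ▸ hlx))

section Relabel

variable {κ' : Type*} {C : κ → κ → ℤ} {A : κ' → κ' → ℤ} {node : κ' → κ}

theorem WeightOrbit.comp (hnode : node.Injective) (hA : ∀ i j, C (node i) (node j) = A i j)
    {J : Set κ'} {i : κ'} {v : κ → ℤ} (hv : WeightOrbit C (node '' J) (node i) v) :
    WeightOrbit A J i (v ∘ node) := by
  induction hv with
  | start v h1 h0 =>
    exact .start _ h1 fun j hj hji ↦ h0 _ ⟨j, hj, rfl⟩ (hnode.ne hji)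
  | reflect v _ j hj ih =>
    obtain ⟨j, hj, rfl⟩ := hj
    convert ih.reflect _ j hj using 1
    ext l
    simp [hA]

theorem WeightOrbit.exists_of_comp (hnode : node.Injective)
    (hA : ∀ i j, C (node i) (node j) = A i j)
    {J : Set κ'} {i : κ'} {w : κ' → ℤ} (hw : WeightOrbit A J i w) :
    ∃ v, WeightOrbit C (node '' J) (node i) v ∧ v ∘ node = w := by
  induction hw with
  | start w h1 h0 =>
    have h (l) : Function.extend node w 0 (node l) = w l := hnode.extend_apply w 0 l
    refine ⟨Function.extend node w 0, .start _ (by rw [h, h1]) ?_, funext h⟩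
    rintro _ ⟨j, hj, rfl⟩ hji
    rw [h, h0 j hj fun h' ↦ hji (congrArg node h')]
  | reflect w _ j hj ih =>
    obtain ⟨v, hv, rfl⟩ := ih
    refine ⟨_, hv.reflect _ (node j) ⟨j, hj, rfl⟩, ?_⟩
    ext l
    simp [hA]

theorem isBraidlessFor_image_iff (hnode : node.Injective)
    (hA : ∀ i j, C (node i) (node j) = A i j) {J : Set κ'} {i : κ'} :
    IsBraidlessFor C (node '' J) (node i) ↔ IsBraidlessFor A J i := by
  constructor
  · intro h w hw j hj l hl hjl hwj hwl
    obtain ⟨v, hv, rfl⟩ := hw.exists_of_comp hnode hA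
    rw [← hA]
    exact h v hv _ ⟨j, hj, rfl⟩ _ ⟨l, hl, rfl⟩ (hnode.ne hjl) hwj hwl
  · rintro h v hv _ ⟨j, hj, rfl⟩ _ ⟨l, hl, rfl⟩ hjl hvj hvl
    rw [hA]
    exact h _ (hv.comp hnode hA) j hj l hl (fun h' ↦ hjl (congrArg node h')) hvj hvl

theorem isGoodSeq_comp_iff (hnode : node.Injective) (hA : ∀ i j, C (node i) (node j) = A i j)
    {n : ℕ} {t : Fin n → κ'} : IsGoodSeq C (node ∘ t) ↔ IsGoodSeq A t := by
  refine forall_congr' fun k ↦ ?_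
  rw [← isBraidlessFor_image_iff hnode hA]
  have : {i | ∃ m, k ≤ m ∧ (node ∘ t) m = i} = node '' {i | ∃ m, k ≤ m ∧ t m = i} := by
    ext i
    simp only [Set.mem_ofPred_eq, Set.mem_image, Function.comp_apply]
    constructor
    · rintro ⟨m, hm, rfl⟩
      exact ⟨_, ⟨m, hm, rfl⟩, rfl⟩
    · rintro ⟨_, ⟨m, hm, rfl⟩, rfl⟩
      exact ⟨m, hm, rfl⟩
  rw [this, Function.comp_apply]

end Relabel

theorem isGoodSeq_succ_iff {C : κ → κ → ℤ} {n : ℕ} {s : Fin (n + 1) → κ} :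
    IsGoodSeq C s ↔ IsBraidlessFor C (Set.range s) (s 0) ∧ IsGoodSeq C (Fin.tail s) := by
  rw [IsGoodSeq, Fin.forall_fin_succ]
  refine and_congr ?_ (forall_congr' fun k ↦ ?_)
  · have : {i | ∃ m, 0 ≤ m ∧ s m = i} = Set.range s := by
      ext i
      simp
    rw [this]
  · have : {i | ∃ m, k.succ ≤ m ∧ s m = i} = {i | ∃ m, k ≤ m ∧ Fin.tail s m = i} := by
      ext i
      simp only [Set.mem_ofPred_eq, Fin.tail]
      constructor
      · rintro ⟨m, hm, rfl⟩
        obtain ⟨m, rfl⟩ := Fin.exists_succ_eq.mpr ((Fin.succ_pos k).trans_le hm).ne'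
        exact ⟨m, by simpa using hm, rfl⟩
      · rintro ⟨m, hm, rfl⟩
        exact ⟨m.succ, by simpa using hm, rfl⟩
    rw [this]
    rfl

/-- Good sequences when the good starting nodes of an end segment `i, i + 1, …` of the diagram are
`i` and the members of a set `S`, each of which leaves a diagram without any restriction. -/
theorem isGoodSeq_iff_exists_prefix {n : ℕ} {A : Fin n → Fin n → ℤ} {S : Set (Fin n)}
    (hS : S.Nonempty)
    (hfirst : ∀ i ∉ S, IsBraidlessFor A {j | i ≤ j} i)
    (hend : ∀ x ∈ S, IsBraidlessFor A Set.univ x)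
    (htail : ∀ x ∈ S, ∀ i ≠ x, IsBraidlessFor A {j | j ≠ x} i)
    (hmid : ∀ i, ∀ j ∉ S, i < j → ¬ IsBraidlessFor A {l | i ≤ l} j)
    {t : Fin n → Fin n} (ht : t.Injective) :
    IsGoodSeq A t ↔ ∃ k, ∃ x ∈ S, (∀ m < k, t m = m) ∧ t k = x := by
  have hsurj : t.Surjective := Finite.injective_iff_surjective.mp ht
  have hset (k : Fin n) (h : ∀ m < k, t m = m) : {i | ∃ m, k ≤ m ∧ t m = i} = {i | k ≤ i} := by
    ext i
    constructor
    · rintro ⟨m, hm, rfl⟩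
      by_contra hlt
      have hlt : t m < k := not_le.mp hlt
      -- Since `t m < k`, the prefix condition says that `t` fixes `t m`; injectivity gives `t m =
      -- m`, against `k ≤ m`.
      exact absurd (ht (h _ hlt)) (by omega)
    · intro hi
      obtain ⟨m, rfl⟩ := hsurj i
      refine ⟨m, ?_, rfl⟩
      by_contra hlt
      have := h m (by omega)
      simp only [Set.mem_ofPred_eq] at hi
      omega
  constructor
  · intro hgood
    have hex : ∃ k, t k ∈ S := by
      obtain ⟨x, hx⟩ := hS
      obtain ⟨k, rfl⟩ := hsurj x
      exact ⟨k, hx⟩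
    -- Up to the first visit to `S`, the remaining nodes form an end segment, and by `hmid` only its
    -- first node can come next.
    obtain ⟨k, hk, hmin⟩ := WellFounded.has_min (wellFounded_lt (α := Fin n)) {k | t k ∈ S} hex
    refine ⟨k, t k, hk, fun m ↦ ?_, rfl⟩
    induction m using WellFoundedLT.induction with
    | ind m ih =>
      intro hmk
      have hm := hset m fun m' hm' ↦ ih m' hm' (hm'.trans hmk)
      have hle : t m ∈ {i | m ≤ i} := hm ▸ ⟨m, le_rfl, rfl⟩
      by_contra hne
      refine hmid m (t m) (fun h ↦ hmin m h hmk) (lt_of_le_of_ne hle (Ne.symm hne)) ?_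
      rw [← hm]
      exact hgood m
  · rintro ⟨k, x, hx, hpre, hk⟩ m
    rcases lt_trichotomy m k with hmk | rfl | hkm
    · rw [hset m fun m' hm' ↦ hpre m' (hm'.trans hmk), hpre m hmk]
      -- The prefix may itself meet `S`: in type D it contains node `n - 1` when it runs through `1,
      -- …, n - 1`.
      by_cases hmS : m ∈ S
      · exact (hend m hmS).mono (Set.subset_univ _)
      · exact hfirst m hmS
    · rw [hk]
      exact (hend x hx).mono (Set.subset_univ _)
    · refine (htail x hx (t m) fun h ↦ hkm.ne (ht (hk.trans h.symm))).mono ?_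
      rintro _ ⟨m', hm', rfl⟩ h
      exact (hkm.trans_le hm').ne (ht (hk.trans h.symm))

end Combinatorics

/-! ### From root systems to Cartan matrices -/

section Bridge

variable {ι K M N : Type*} [Field K] [AddCommGroup M] [Module K M] [AddCommGroup N] [Module K N]
  {P : RootPairing ι K M N}

theorem coroot'_reflection (j l : ι) (x : M) :
    P.coroot' l (P.reflection j x) = P.coroot' l x - P.coroot' j x * P.pairing j l := by
  simp [RootPairing.reflection_apply]

theorem isPosInteger_intCast_iff [CharZero K] (a : ℤ) : IsPosInteger (a : K) ↔ 0 < a := by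
  constructor
  · rintro ⟨m, hm, h⟩
    have : a = m := by exact_mod_cast h
    omega
  · intro h
    refine ⟨a.toNat, by omega, ?_⟩
    have : (a.toNat : ℤ) = a := by omega
    exact_mod_cast this.symm

variable [Finite ι] [CharZero K] [P.IsRootSystem] [P.IsCrystallographic]

/-- A product of simple reflections applied to `ω_i` has the pairings computed by the same word in
`WeightOrbit`, and conversely. -/
theorem isBraidless_iff (b : P.Base) {J : Set b.support} {i : b.support} (hi : i ∈ J) :
    IsBraidless P ((↑) '' J) i ↔ IsBraidlessFor b.cartanMatrix J i := by
  classical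
  have hC (j l : b.support) : P.pairing j l = (b.cartanMatrix j l : K) :=
    (b.algebraMap_cartanMatrixIn_apply ℤ j l).symm
  have hzero (j l : b.support) : P.pairing j l = 0 ↔ b.cartanMatrix j l = 0 := by
    rw [hC, Int.cast_eq_zero]
  have hsub : ((↑) '' J : Set ι) ⊆ b.support := by
    rintro _ ⟨j, -, rfl⟩
    exact j.2
  constructor
  · intro h v hv j hj l hl hjl hvj hvl
    -- The hypothesis quantifies over fundamental weights, so one has to exist before it can be
    -- applied.
    obtain ⟨ω, hω, -⟩ := existsUnique_isFundamentalWeight b hsub ⟨i, hi, rfl⟩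
    have key : ∃ τ ∈ weylGroup P ((↑) '' J), ∀ j ∈ J, P.coroot' j (τ ω) = (v j : K) := by
      clear hvj hvl
      induction hv with
      | start v h1 h0 =>
        refine ⟨1, one_mem _, fun j hj ↦ ?_⟩
        by_cases hji : j = i
        · subst hji
          simpa [h1] using hω.2.1
        · simpa [h0 j hj hji] using hω.2.2 j ⟨j, hj, rfl⟩ fun h ↦ hji (Subtype.ext h)
      | reflect v _ k hk ih =>
        obtain ⟨τ, hτ, hτv⟩ := ih
        refine ⟨P.reflection k * τ,
          mul_mem (Subgroup.subset_closure ⟨k, ⟨k, hk, rfl⟩, rfl⟩) hτ, fun l hl ↦ ?_⟩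
        rw [LinearEquiv.mul_apply, coroot'_reflection, hτv l hl, hτv k hk, hC]
        push_cast
        rfl
    obtain ⟨τ, hτ, hτv⟩ := key
    rw [← hzero]
    refine h ω hω τ hτ j ⟨j, hj, rfl⟩ l ⟨l, hl, rfl⟩ (fun h ↦ hjl (Subtype.ext h)) ?_ ?_
    · rwa [hτv j hj, isPosInteger_intCast_iff]
    · rwa [hτv l hl, isPosInteger_intCast_iff]
  · intro h ω hω τ hτ
    have key : ∃ v, WeightOrbit b.cartanMatrix J i v ∧
        ∀ j ∈ J, P.coroot' j (τ ω) = (v j : K) := by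
      have hrefl (k : b.support) (hk : k ∈ J) (τ : M ≃ₗ[K] M)
          (ih : ∃ v, WeightOrbit b.cartanMatrix J i v ∧ ∀ j ∈ J, P.coroot' j (τ ω) = (v j : K)) :
          ∃ v, WeightOrbit b.cartanMatrix J i v ∧
            ∀ j ∈ J, P.coroot' j ((P.reflection k * τ) ω) = (v j : K) := by
        obtain ⟨v, hv, hvτ⟩ := ih
        refine ⟨_, hv.reflect _ k hk, fun l hl ↦ ?_⟩
        rw [LinearEquiv.mul_apply, coroot'_reflection, hvτ l hl, hvτ k hk, hC]
        push_cast
        rfl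
      induction hτ using Subgroup.closure_induction_left with
      | one =>
        refine ⟨Pi.single i 1, .start _ (by simp) fun j _ hj ↦ by simp [hj], fun j hj ↦ ?_⟩
        by_cases hji : j = i
        · subst hji
          simpa using hω.2.1
        · simpa [hji] using hω.2.2 j ⟨j, hj, rfl⟩ fun h ↦ hji (Subtype.ext h)
      | mul_left x hx y hy ih =>
        obtain ⟨_, ⟨k, hk, rfl⟩, rfl⟩ := hx
        exact hrefl k hk y ih
      | inv_mul_cancel x hx y hy ih =>
        obtain ⟨_, ⟨k, hk, rfl⟩, rfl⟩ := hx
        -- Reflections are involutions, so inverse generators give nothing new.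
        rw [P.reflection_inv]
        exact hrefl k hk y ih
    obtain ⟨v, hv, hvτ⟩ := key
    rintro _ ⟨j, hj, rfl⟩ _ ⟨l, hl, rfl⟩ hjl hvj hvl
    rw [hvτ j hj, isPosInteger_intCast_iff] at hvj
    rw [hvτ l hl, isPosInteger_intCast_iff] at hvl
    rw [hzero]
    exact h v hv j hj l hl (fun h ↦ hjl (congrArg _ h)) hvj hvl

theorem isGood_iff {b : P.Base} {n : ℕ} (s : Fin n ≃ b.support) :
    IsGood s ↔ IsGoodSeq b.cartanMatrix s := by
  refine forall_congr' fun k ↦ ?_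
  rw [← isBraidless_iff b (J := {i | ∃ m, k ≤ m ∧ s m = i}) ⟨k, le_rfl, rfl⟩]
  have : {i | ∃ m, k ≤ m ∧ (s m : ι) = i} = (↑) '' {i | ∃ m, k ≤ m ∧ s m = i} := by
    ext i
    constructor
    · rintro ⟨m, hm, rfl⟩
      exact ⟨_, ⟨m, hm, rfl⟩, rfl⟩
    · rintro ⟨_, ⟨m, hm, rfl⟩, rfl⟩
      exact ⟨m, hm, rfl⟩
  rw [this]

end Bridge

/-- Exchange of the entries `m` and `m + 1` of a sequence. -/
def exchange (m : ℕ) (x : ℕ → ℤ) : ℕ → ℤ :=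
  fun l ↦ if l = m then x (m + 1) else if l = m + 1 then x m else x l

theorem exists_exchange_eq (m : ℕ) (x : ℕ → ℤ) (l : ℕ) : ∃ l', exchange m x l = x l' := by
  unfold exchange
  split_ifs <;> exact ⟨_, rfl⟩

/-! ### Type A -/

/-- If the diagram on `J` is a disjoint union of simply laced paths, embedded into the path of the
natural numbers by `c`, then every node is braidless. -/
theorem isBraidlessFor_of_path {κ : Type*} {C : κ → κ → ℤ} {J : Set κ} (c : κ → ℕ)
    (hc : Set.InjOn c J)
    (hC : ∀ j ∈ J, ∀ l ∈ J, C j l =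
      if c j = c l then 2 else if c j + 1 = c l ∨ c l + 1 = c j then -1 else 0)
    {i : κ} (hi : i ∈ J) : IsBraidlessFor C J i := by
  -- Node `m` of the path pairs as `x m - x (m + 1)`, and `ω_i` is the sequence of ones up to `c i`.
  -- Adjacent positive pairings would need three strictly decreasing values, but there are only two.
  refine .of_model (fun j x ↦ x (c j) - x (c j + 1)) (fun j x ↦ exchange (c j) x)
    {x | ∀ m, x m = 0 ∨ x m = 1} 1 one_pos ?_ ?_ (fun m ↦ if m ≤ c i then 1 else 0) ?_ ?_ ?_ ?_
  · intro x hx j _ m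
    obtain ⟨m', hm'⟩ := exists_exchange_eq (c j) x m
    rw [hm']
    exact hx m'
  · intro x _ j hj l hl
    rw [hC j hj l hl]
    simp only [exchange]
    grind
  · intro m
    dsimp only
    split_ifs <;> simp
  · simp
  · intro j hj hji
    have := hc.ne hj hi hji
    grind
  · intro x hx j hj l hl hjl hjx hlx
    have := hc.ne hj hl hjl
    have h1 := hx (c j)
    have h2 := hx (c j + 1)
    have h3 := hx (c l)
    have h4 := hx (c l + 1)
    rw [hC l hl j hj]
    grind

theorem isGoodSeq_of_path {n : ℕ} {s : Fin n → Fin n} : IsGoodSeq (CartanMatrix.A n) s := by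
  intro k
  refine (isBraidlessFor_of_path (J := Set.univ) Fin.val Fin.val_injective.injOn ?_
    (Set.mem_univ _)).mono (Set.subset_univ _)
  intro j _ l _
  simp only [CartanMatrix.A, Matrix.of_apply, Fin.ext_iff]

/-! ### Types B and C -/

/-- The coordinates in types B (with `p = 2`) and C (with `p = 1`). -/
def coordBC (p : ℤ) (n : ℕ) (j : Fin n) (x : ℕ → ℤ) : ℤ :=
  if (j : ℕ) + 1 = n then p * x j else x j - x (j + 1)

/-- The simple reflections in types B and C. -/
def reflBC (n : ℕ) (j : Fin n) (x : ℕ → ℤ) : ℕ → ℤ :=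
  fun l ↦ if (j : ℕ) + 1 = n then if l = j then - x l else x l else exchange j x l

/-- The coordinates in type D. -/
def coordD (n : ℕ) (j : Fin n) (x : ℕ → ℤ) : ℤ :=
  if (j : ℕ) + 1 = n then x (n - 2) + x (n - 1) else x j - x (j + 1)

/-- The simple reflections in type D. -/
def reflD (n : ℕ) (j : Fin n) (x : ℕ → ℤ) : ℕ → ℤ :=
  fun l ↦ if (j : ℕ) + 1 = n then
    if l = n - 2 then - x (n - 1) else if l = n - 1 then - x (n - 2) else x l
  else exchange j x l

theorem coordBC_reflBC_B {n : ℕ} (j l : Fin n) (x : ℕ → ℤ) :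
    coordBC 2 n l (reflBC n j x) = coordBC 2 n l x - coordBC 2 n j x * CartanMatrix.B n j l := by
  simp only [coordBC, reflBC, exchange, CartanMatrix.B, Matrix.of_apply, Fin.ext_iff]
  have := j.2
  have := l.2
  grind

theorem coordBC_reflBC_C {n : ℕ} (j l : Fin n) (x : ℕ → ℤ) :
    coordBC 1 n l (reflBC n j x) = coordBC 1 n l x - coordBC 1 n j x * CartanMatrix.C n j l := by
  simp only [coordBC, reflBC, exchange, CartanMatrix.C, Matrix.of_apply, Fin.ext_iff]
  have := j.2
  have := l.2
  grind

theorem coordD_reflD {n : ℕ} (hn : 3 ≤ n) (j l : Fin n) (x : ℕ → ℤ) :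
    coordD n l (reflD n j x) = coordD n l x - coordD n j x * CartanMatrix.D n j l := by
  simp only [coordD, reflD, exchange, CartanMatrix.D, Matrix.of_apply, Fin.ext_iff]
  have := j.2
  have := l.2
  grind (splits := 25)

/-- The points `± e_m` and the origin. -/
def axisPoints : Set (ℕ → ℤ) :=
  {x | (∀ m, x m = -1 ∨ x m = 0 ∨ x m = 1) ∧ ∀ m m', m ≠ m' → x m = 0 ∨ x m' = 0}

/-- The sequences of signs. -/
def signPoints : Set (ℕ → ℤ) := {x | ∀ m, x m = -1 ∨ x m = 1}

theorem single_mem_axisPoints (i : ℕ) : (fun m ↦ if m = i then 1 else 0) ∈ axisPoints := by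
  constructor
  · intro m
    dsimp only
    split_ifs <;> simp
  · intro m m' h
    dsimp only
    grind

theorem reflBC_mem_axisPoints {n : ℕ} (j : Fin n) {x : ℕ → ℤ} (hx : x ∈ axisPoints) :
    reflBC n j x ∈ axisPoints := by
  obtain ⟨h1, h2⟩ := hx
  constructor
  · intro m
    have := h1 m
    have := h1 j
    have := h1 (j + 1)
    simp only [reflBC, exchange]
    grind
  · intro m m' h
    simp only [reflBC, exchange]
    grind

theorem reflD_mem_axisPoints {n : ℕ} (j : Fin n) {x : ℕ → ℤ} (hx : x ∈ axisPoints) :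
    reflD n j x ∈ axisPoints := by
  obtain ⟨h1, h2⟩ := hx
  constructor
  · intro m
    have := h1 m
    have := h1 j
    have := h1 (j + 1)
    have := h1 (n - 1)
    have := h1 (n - 2)
    simp only [reflD, exchange]
    grind
  · intro m m' h
    simp only [reflD, exchange]
    grind

theorem reflBC_mem_signPoints {n : ℕ} (j : Fin n) {x : ℕ → ℤ} (hx : x ∈ signPoints) :
    reflBC n j x ∈ signPoints := by
  intro m
  have := hx m
  have := hx j
  have := hx (j + 1)
  simp only [reflBC, exchange]
  grind

theorem reflD_mem_signPoints {n : ℕ} (j : Fin n) {x : ℕ → ℤ} (hx : x ∈ signPoints) :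
    reflD n j x ∈ signPoints := by
  intro m
  have := hx m
  have := hx j
  have := hx (j + 1)
  have := hx (n - 1)
  have := hx (n - 2)
  simp only [reflD, exchange]
  grind

/-- The properties shared by the Cartan matrices of types B and C. -/
structure IsTypeBC (p : ℤ) {n : ℕ} (A : Fin n → Fin n → ℤ) : Prop where
  pos : 0 < p
  refl : ∀ j l x, coordBC p n l (reflBC n j x) = coordBC p n l x - coordBC p n j x * A j l
  eq_zero : ∀ j l : Fin n, j ≠ l → (j : ℕ) + 1 ≠ l → (l : ℕ) + 1 ≠ j → A j l = 0
  ne_zero : ∀ j l : Fin n, (l : ℕ) + 1 = j → A j l ≠ 0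
  path : ∀ j l : Fin n, (j : ℕ) + 1 ≠ n → (l : ℕ) + 1 ≠ n →
    A j l = if (j : ℕ) = l then 2 else if (j : ℕ) + 1 = l ∨ (l : ℕ) + 1 = j then -1 else 0

theorem isTypeBC_B (n : ℕ) : IsTypeBC 2 (CartanMatrix.B n) where
  pos := two_pos
  refl := coordBC_reflBC_B
  eq_zero j l := by simp only [CartanMatrix.B, Matrix.of_apply]; grind
  ne_zero j l := by simp only [CartanMatrix.B, Matrix.of_apply]; grind
  path j l := by simp only [CartanMatrix.B, Matrix.of_apply]; grind

theorem isTypeBC_C (n : ℕ) : IsTypeBC 1 (CartanMatrix.C n) where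
  pos := one_pos
  refl := coordBC_reflBC_C
  eq_zero j l := by simp only [CartanMatrix.C, Matrix.of_apply]; grind
  ne_zero j l := by simp only [CartanMatrix.C, Matrix.of_apply]; grind
  path j l := by simp only [CartanMatrix.C, Matrix.of_apply]; grind

/-- The point `(1, …, 1, 0, …, 0, ε, 0, …)` with `j` leading ones and `ε` at position `q`. -/
def movingPoint (j : ℕ) (ε : ℤ) (q : ℕ) : ℕ → ℤ :=
  fun m ↦ if m < j then 1 else if m = q then ε else 0

theorem exchange_movingPoint {j q : ℕ} (h : j ≤ q) (ε : ℤ) :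
    exchange q (movingPoint j ε q) = movingPoint j ε (q + 1) := by
  ext m
  simp only [exchange, movingPoint]
  grind

theorem exchange_movingPoint_succ {j q : ℕ} (h : j ≤ q) (ε : ℤ) :
    exchange q (movingPoint j ε (q + 1)) = movingPoint j ε q := by
  ext m
  simp only [exchange, movingPoint]
  grind

/-- For use with `Q` = being reached: the exchanges at positions `m ≥ j` are simple reflections that
leave the leading ones alone. -/
theorem movingPoint_up {n : ℕ} {Q : (ℕ → ℤ) → Prop} {j : ℕ}
    (hQ : ∀ m, j ≤ m → m + 1 < n → ∀ x, Q x → Q (exchange m x)) {ε : ℤ} {q r : ℕ}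
    (hq : j ≤ q) (hqr : q ≤ r) (hr : r < n)
    (h : Q (movingPoint j ε q)) : Q (movingPoint j ε r) := by
  induction r, hqr using Nat.le_induction with
  | base => exact h
  | succ r hqr ih =>
    rw [← exchange_movingPoint (hq.trans hqr)]
    exact hQ r (hq.trans hqr) hr _ (ih (by omega))

theorem movingPoint_down {n : ℕ} {Q : (ℕ → ℤ) → Prop} {j : ℕ}
    (hQ : ∀ m, j ≤ m → m + 1 < n → ∀ x, Q x → Q (exchange m x)) {ε : ℤ} {q r : ℕ}
    (hq : j ≤ q) (hqr : q ≤ r) (hr : r < n)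
    (h : Q (movingPoint j ε r)) : Q (movingPoint j ε q) := by
  induction r, hqr using Nat.le_induction with
  | base => exact h
  | succ r hqr ih =>
    refine ih (by omega) ?_
    rw [← exchange_movingPoint_succ (hq.trans hqr)]
    exact hQ r (hq.trans hqr) hr _ h

namespace IsTypeBC

variable {p : ℤ} {n : ℕ} {A : Fin n → Fin n → ℤ}

/-- Adjacent positive pairings mean `x j > x (j + 1) > x (j + 2)`, which needs both a `1` and a
`-1`, or `x (n - 2) > x (n - 1) > 0`, which needs an entry above 1. Neither occurs among `± e_m`. -/
theorem isBraidlessFor_first (hA : IsTypeBC p A) {i : Fin n} (hi : (i : ℕ) + 1 ≠ n) :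
    IsBraidlessFor A {j | i ≤ j} i := by
  have hp := hA.pos
  refine .of_model (coordBC p n) (reflBC n) axisPoints 1 one_pos
    (fun x hx j _ ↦ reflBC_mem_axisPoints j hx) (fun x _ j _ l _ ↦ hA.refl j l x)
    _ (single_mem_axisPoints i) ?_ ?_ ?_
  · simp [coordBC, hi]
  · intro j hj hji
    have hj : i ≤ j := hj
    have : (j : ℕ) ≠ i := fun h ↦ hji (Fin.ext h)
    simp only [coordBC]
    grind
  · intro x hx j _ l _ hjl hjx hlx
    refine hA.eq_zero l j hjl.symm (fun h ↦ ?_) (fun h ↦ ?_)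
    all_goals
      obtain ⟨h1, h2⟩ := hx
      have := h1 j
      have := h1 l
      have := h1 (j + 1)
      have := h1 (l + 1)
      simp only [coordBC] at hjx hlx
      have hpj := pos_iff_pos_of_mul_pos (a := p) (b := x j)
      have hpl := pos_iff_pos_of_mul_pos (a := p) (b := x l)
      grind

/-- Two values `± 1` allow neither `x j > x (j + 1) > x (j + 2)` nor `x (n - 2) > x (n - 1) > 0`.
The all-ones vector pairs to `p` with the last coroot, hence the scale `p`. -/
theorem isBraidlessFor_last (hA : IsTypeBC p A) (hp2 : p = 1 ∨ p = 2) {i : Fin n}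
    (hi : (i : ℕ) + 1 = n) : IsBraidlessFor A Set.univ i := by
  refine .of_model (coordBC p n) (reflBC n) signPoints p hA.pos
    (fun x hx j _ ↦ reflBC_mem_signPoints j hx) (fun x _ j _ l _ ↦ hA.refl j l x)
    (fun _ ↦ 1) (fun _ ↦ .inr rfl) ?_ ?_ ?_
  · simp [coordBC, hi]
  · intro j _ hji
    have : (j : ℕ) ≠ i := fun h ↦ hji (Fin.ext h)
    simp only [coordBC]
    grind
  · intro x hx j _ l _ hjl hjx hlx
    refine hA.eq_zero l j hjl.symm (fun h ↦ ?_) (fun h ↦ ?_)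
    all_goals
      have := hx j
      have := hx l
      have := hx (j + 1)
      have := hx (l + 1)
      simp only [coordBC] at hjx hlx
      grind

theorem isBraidlessFor_path (hA : IsTypeBC p A) {x : Fin n} (hx : (x : ℕ) + 1 = n) {i : Fin n}
    (hi : i ≠ x) : IsBraidlessFor A {j | j ≠ x} i := by
  have h (j : Fin n) (hj : j ≠ x) : (j : ℕ) + 1 ≠ n := fun h ↦ hj (Fin.ext (by omega))
  exact isBraidlessFor_of_path Fin.val Fin.val_injective.injOn
    (fun j hj l hl ↦ hA.path j l (h j hj) (h l hl)) hi

/-- Start from `ω_j = (1, …, 1, 0, …, 0)`, move the last `1` to the end, reverse its sign there and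
bring it back to position `j + 1`. The result `(1, …, 1, 0, -1, 0, …)` descends both at `j - 1` and
at `j`. -/
theorem not_isBraidlessFor (hA : IsTypeBC p A) {i j : Fin n} (hj : (j : ℕ) + 1 ≠ n) (hij : i < j) :
    ¬ IsBraidlessFor A {l | i ≤ l} j := by
  set J : Set (Fin n) := {l | i ≤ l} with hJ
  have hrefl (m : Fin n) (hm : i ≤ m) (x) (hx : IsReached A J j (coordBC p n) x) :
      IsReached A J j (coordBC p n) (reflBC n m x) :=
    hx.reflect m hm fun l _ ↦ hA.refl m l x
  have hQ (m : ℕ) (hm : (j : ℕ) ≤ m) (hmn : m + 1 < n) (x)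
      (hx : IsReached A J j (coordBC p n) x) :
      IsReached A J j (coordBC p n) (exchange m x) := by
    convert hrefl ⟨m, by omega⟩ (hij.le.trans hm) x hx using 1
    ext l
    simp [reflBC, hmn.ne]
  have h0 : IsReached A J j (coordBC p n) (movingPoint j 1 j) := by
    refine .start ?_ fun l _ hlj ↦ ?_
    · simp [coordBC, hj, movingPoint]
    · have : (l : ℕ) ≠ j := fun h ↦ hlj (Fin.ext h)
      simp only [coordBC, movingPoint]
      grind
  have h1 := movingPoint_up hQ le_rfl (by omega : (j : ℕ) ≤ n - 1) (by omega) h0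
  have h2 : IsReached A J j (coordBC p n) (movingPoint j (-1) (n - 1)) := by
    convert hrefl ⟨n - 1, by omega⟩ (by simp only [Fin.le_def]; omega) _ h1 using 1
    ext l
    simp only [reflBC, movingPoint]
    grind
  have h3 := movingPoint_down hQ (by omega : (j : ℕ) ≤ j + 1) (by omega) (by omega) h2
  refine h3.not_isBraidlessFor (j := ⟨j - 1, by omega⟩) (l := j) ?_ hij.le ?_ ?_ ?_ ?_
  · simp only [hJ, Set.mem_ofPred_eq, Fin.le_def]
    omega
  · simp only [ne_eq, Fin.ext_iff]
    omega
  · exact hA.ne_zero _ _ (by simp only; omega)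
  · simp only [coordBC, movingPoint]
    grind
  · simp only [coordBC, movingPoint]
    grind

theorem isGoodSeq_iff (hA : IsTypeBC p A) (hp : p = 1 ∨ p = 2) (hn : 0 < n) {κ : Type*}
    {C : κ → κ → ℤ} {node s : Fin n → κ} (hnode : node.Injective)
    (hC : ∀ i j, C (node i) (node j) = A i j) (hs : s.Injective) (hsn : ∀ m, s m ∈ Set.range node) :
    IsGoodSeq C s ↔ RuleBC node s := by
  choose t ht using hsn
  obtain rfl : node ∘ t = s := funext ht
  rw [isGoodSeq_comp_iff hnode hC, isGoodSeq_iff_exists_prefix (S := {x | (x : ℕ) + 1 = n})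
    ⟨⟨n - 1, by omega⟩, Nat.sub_add_cancel hn⟩ (fun i hi ↦ hA.isBraidlessFor_first hi)
    (fun x hx ↦ hA.isBraidlessFor_last hp hx) (fun x hx i hi ↦ hA.isBraidlessFor_path hx hi)
    (fun i j hj hij ↦ hA.not_isBraidlessFor hj hij) hs.of_comp]
  simp [RuleBC, hnode.eq_iff]

end IsTypeBC

/-! ### Type D -/

section TypeD

open CartanMatrix (D)

variable {n : ℕ}

/-- The hypotheses exclude the edges: consecutive indices other than the orthogonal pair `n - 2`, `n
- 1`, and the edge joining `n - 3` to `n - 1`. -/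
theorem D_eq_zero {j l : Fin n} (hjl : j ≠ l) (h1 : (j : ℕ) + 1 = l → (l : ℕ) + 1 = n)
    (h2 : (l : ℕ) + 1 = j → (j : ℕ) + 1 = n) (h3 : (j : ℕ) + 3 = n → (l : ℕ) + 1 ≠ n)
    (h4 : (l : ℕ) + 3 = n → (j : ℕ) + 1 ≠ n) : D n j l = 0 := by
  simp only [D, Matrix.of_apply]
  grind

theorem isBraidlessFor_D_first (hn : 3 ≤ n) {i : Fin n} (hi : (i : ℕ) + 2 < n) :
    IsBraidlessFor (D n) {j | i ≤ j} i := by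
  refine .of_model (coordD n) (reflD n) axisPoints 1 one_pos
    (fun x hx j _ ↦ reflD_mem_axisPoints j hx) (fun x _ j _ l _ ↦ coordD_reflD hn j l x)
    _ (single_mem_axisPoints i) ?_ ?_ ?_
  · simp only [coordD]
    grind
  · intro j hj hji
    have hj : i ≤ j := hj
    have : (j : ℕ) ≠ i := fun h ↦ hji (Fin.ext h)
    simp only [coordD]
    grind
  · intro x hx j _ l _ hjl hjx hlx
    obtain ⟨h1, h2⟩ := hx
    have := h1 j
    have := h1 l
    have := h1 (j + 1)
    have := h1 (l + 1)
    have := h1 (n - 1)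
    have := h1 (n - 2)
    simp only [coordD] at hjx hlx
    refine D_eq_zero hjl.symm (fun h ↦ ?_) (fun h ↦ ?_) (fun h h' ↦ ?_) (fun h h' ↦ ?_)
    · grind
    · grind
    -- On the branch edge, `x (n - 2) + x (n - 1) > 0` makes one of the two entries `1` and all
    -- other entries `0`, so `x l > x (n - 2)` fails.
    · have e : (l : ℕ) + 1 = n - 2 := by omega
      have := h2 l (n - 2) (by omega)
      have := h2 l (n - 1) (by omega)
      have := h2 (n - 2) (n - 1) (by omega)
      rw [e] at hlx
      grind
    · have e : (j : ℕ) + 1 = n - 2 := by omega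
      have := h2 j (n - 2) (by omega)
      have := h2 j (n - 1) (by omega)
      have := h2 (n - 2) (n - 1) (by omega)
      rw [e] at hjx
      grind

theorem isBraidlessFor_D_last (hn : 3 ≤ n) {i : Fin n} (hi : (i : ℕ) + 2 = n ∨ (i : ℕ) + 1 = n) :
    IsBraidlessFor (D n) Set.univ i := by
  refine .of_model (coordD n) (reflD n) signPoints 2 two_pos
    (fun x hx j _ ↦ reflD_mem_signPoints j hx) (fun x _ j _ l _ ↦ coordD_reflD hn j l x)
    -- Twice a half-spin weight. For `i = n - 2` the last entry is `-1`; for `i = n - 1` the `-1`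
    -- sits at position `n`, which no coordinate sees.
    (fun m ↦ if m = i + 1 then -1 else 1) ?_ ?_ ?_ ?_
  · intro m
    dsimp only
    split_ifs <;> simp
  · simp only [coordD]
    grind
  · intro j _ hji
    have : (j : ℕ) ≠ i := fun h ↦ hji (Fin.ext h)
    simp only [coordD]
    grind
  · intro x hx j _ l _ hjl hjx hlx
    have := hx j
    have := hx l
    have := hx (j + 1)
    have := hx (l + 1)
    have := hx (n - 1)
    have := hx (n - 2)
    simp only [coordD] at hjx hlx
    refine D_eq_zero hjl.symm (fun h ↦ ?_) (fun h ↦ ?_) (fun h h' ↦ ?_) (fun h h' ↦ ?_) <;> grind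

theorem isBraidlessFor_D_path (hn : 3 ≤ n) {x : Fin n} (hx : (x : ℕ) + 2 = n ∨ (x : ℕ) + 1 = n)
    {i : Fin n} (hi : i ≠ x) : IsBraidlessFor (D n) {j | j ≠ x} i := by
  -- Without one of the two end nodes the other one takes place `n - 2` on the path.
  refine isBraidlessFor_of_path (J := {j | j ≠ x}) (fun j ↦ if (j : ℕ) + 1 = n then n - 2 else j)
    ?_ ?_ hi
  · intro j hj l hl h
    simp only [Set.mem_ofPred_eq, ne_eq, Fin.ext_iff] at hj hl h ⊢
    grind
  · intro j hj l hl
    simp only [Set.mem_ofPred_eq, ne_eq, Fin.ext_iff] at hj hl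
    simp only [D, Matrix.of_apply, Fin.ext_iff]
    grind (splits := 20)

theorem not_isBraidlessFor_D (hn : 3 ≤ n) {i j : Fin n} (hj : (j : ℕ) + 2 < n) (hij : i < j) :
    ¬ IsBraidlessFor (D n) {l | i ≤ l} j := by
  set J : Set (Fin n) := {l | i ≤ l} with hJ
  have hrefl (m : Fin n) (hm : i ≤ m) (x) (hx : IsReached (D n) J j (coordD n) x) :
      IsReached (D n) J j (coordD n) (reflD n m x) :=
    hx.reflect m hm fun l _ ↦ coordD_reflD hn m l x
  have hQ (m : ℕ) (hm : (j : ℕ) ≤ m) (hmn : m + 1 < n) (x)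
      (hx : IsReached (D n) J j (coordD n) x) :
      IsReached (D n) J j (coordD n) (exchange m x) := by
    convert hrefl ⟨m, by omega⟩ (hij.le.trans hm) x hx using 1
    ext l
    simp [reflD, hmn.ne]
  have h0 : IsReached (D n) J j (coordD n) (movingPoint j 1 j) := by
    refine .start ?_ fun l _ hlj ↦ ?_
    · simp only [coordD, movingPoint]
      grind
    · have : (l : ℕ) ≠ j := fun h ↦ hlj (Fin.ext h)
      simp only [coordD, movingPoint]
      grind
  have h1 := movingPoint_up hQ le_rfl (by omega : (j : ℕ) ≤ n - 1) (by omega) h0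
  -- The last reflection exchanges the final two entries with both signs reversed, so the `-1` lands
  -- at `n - 2`; this is at least `j + 1`.
  have h2 : IsReached (D n) J j (coordD n) (movingPoint j (-1) (n - 2)) := by
    convert hrefl ⟨n - 1, by omega⟩ (by simp only [Fin.le_def]; omega) _ h1 using 1
    ext l
    simp only [reflD, movingPoint]
    grind
  have h3 := movingPoint_down hQ (by omega : (j : ℕ) ≤ j + 1) (by omega) (by omega) h2
  refine h3.not_isBraidlessFor (j := ⟨j - 1, by omega⟩) (l := j) ?_ hij.le ?_ ?_ ?_ ?_
  · simp only [hJ, Set.mem_ofPred_eq, Fin.le_def]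
    omega
  · simp only [ne_eq, Fin.ext_iff]
    omega
  · simp only [D, Matrix.of_apply]
    grind
  · simp only [coordD, movingPoint]
    grind
  · simp only [coordD, movingPoint]
    grind

theorem isGoodSeq_D_iff (hn : 3 ≤ n) {κ : Type*}
    {C : κ → κ → ℤ} {node s : Fin n → κ} (hnode : node.Injective)
    (hC : ∀ i j, C (node i) (node j) = D n i j) (hs : s.Injective)
    (hsn : ∀ m, s m ∈ Set.range node) : IsGoodSeq C s ↔ RuleD node s := by
  choose t ht using hsn
  obtain rfl : node ∘ t = s := funext ht
  rw [isGoodSeq_comp_iff hnode hC,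
    isGoodSeq_iff_exists_prefix (S := {x | (x : ℕ) + 2 = n ∨ (x : ℕ) + 1 = n})
      ⟨⟨n - 1, by omega⟩, .inr (Nat.sub_add_cancel (by omega))⟩
      (fun i hi ↦ isBraidlessFor_D_first hn (by simp only [Set.mem_ofPred_eq] at hi; omega))
      (fun x hx ↦ isBraidlessFor_D_last hn hx) (fun x hx i hi ↦ isBraidlessFor_D_path hn hx hi)
      (fun i j hj hij ↦ not_isBraidlessFor_D hn (by simp only [Set.mem_ofPred_eq] at hj; omega) hij)
      hs.of_comp]
  simp [RuleD, hnode.eq_iff]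

end TypeD

/-! ### Exceptional types -/

section Finite

variable {n : ℕ}

/-- The coordinates of a list of pairings. -/
def coordList (l : Fin n) (x : List ℤ) : ℤ := x.getD l 0

/-- The action of the simple reflections on lists of pairings. -/
def reflList (A : Matrix (Fin n) (Fin n) ℤ) (j : Fin n) (x : List ℤ) : List ℤ :=
  List.ofFn fun l ↦ coordList l x - coordList j x * A j l

/-- The pairings of the fundamental weight `ω_i`. -/
def startList (i : Fin n) : List ℤ := List.ofFn fun l ↦ if l = i then 1 else 0

theorem coordList_ofFn (l : Fin n) (f : Fin n → ℤ) : coordList l (List.ofFn f) = f l := by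
  simp [coordList]

theorem coordList_reflList (A : Matrix (Fin n) (Fin n) ℤ) (j l : Fin n) (x : List ℤ) :
    coordList l (reflList A j x) = coordList l x - coordList j x * A j l :=
  coordList_ofFn l _

/-- The word is a certificate, its letters applied from left to right, and evaluating it is a finite
computation. -/
theorem not_isBraidlessFor_of_word {A : Matrix (Fin n) (Fin n) ℤ} {i : Fin n} (w : List (Fin n))
    (j l : Fin n) (hjl : j ≠ l) (hA : A l j ≠ 0)
    (hw : 0 < coordList j (w.foldl (fun x k ↦ reflList A k x) (startList i)) ∧
      0 < coordList l (w.foldl (fun x k ↦ reflList A k x) (startList i))) :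
    ¬ IsBraidlessFor A Set.univ i := by
  have key (w : List (Fin n)) (x) (hx : IsReached A Set.univ i coordList x) :
      IsReached A Set.univ i coordList (w.foldl (fun x k ↦ reflList A k x) x) := by
    induction w generalizing x with
    | nil => exact hx
    | cons k w ih =>
      exact ih _ (hx.reflect k (Set.mem_univ k) fun l _ ↦ coordList_reflList A k l x)
  refine (key w (startList i) (.start ?_ fun l _ hl ↦ ?_)).not_isBraidlessFor
    (Set.mem_univ j) (Set.mem_univ l) hjl hA hw.1 hw.2
  · simp [startList, coordList_ofFn]
  · simp [startList, coordList_ofFn, hl]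

theorem isBraidlessFor_of_orbit {A : Matrix (Fin n) (Fin n) ℤ} {i : Fin n} (X : List (List ℤ))
    (hX : startList i ∈ X) (hr : ∀ x ∈ X, ∀ j, reflList A j x ∈ X)
    (hb : ∀ x ∈ X, ∀ j l, j ≠ l → 0 < coordList j x → 0 < coordList l x → A l j = 0) :
    IsBraidlessFor A Set.univ i :=
  .of_model coordList (reflList A) {x | x ∈ X} 1 one_pos (fun x hx j _ ↦ hr x hx j)
    (fun x _ j _ l _ ↦ coordList_reflList A j l x) (startList i) hX
    (by simp [startList, coordList_ofFn]) (fun l _ hl ↦ by simp [startList, coordList_ofFn, hl])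
    (fun x hx j _ l _ ↦ hb x hx j l)

end Finite

open CartanMatrix (E₆ E₇ E₈ F₄ G₂)

/-- The list consists of the 27 weights of a minuscule representation. -/
theorem isBraidlessFor_E₆_zero : IsBraidlessFor E₆ Set.univ 0 :=
  isBraidlessFor_of_orbit
  [[1, 0, 0, 0, 0, 0], [-1, 0, 1, 0, 0, 0], [0, 0, -1, 1, 0, 0], [0, 1, 0, -1, 1, 0],
   [0, -1, 0, 0, 1, 0], [0, 1, 0, 0, -1, 1], [0, -1, 0, 1, -1, 1], [0, 1, 0, 0, 0, -1],
   [0, 0, 1, -1, 0, 1], [0, -1, 0, 1, 0, -1], [1, 0, -1, 0, 0, 1], [0, 0, 1, -1, 1, -1],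
   [-1, 0, 0, 0, 0, 1], [1, 0, -1, 0, 1, -1], [0, 0, 1, 0, -1, 0], [-1, 0, 0, 0, 1, -1],
   [1, 0, -1, 1, -1, 0], [-1, 0, 0, 1, -1, 0], [1, 1, 0, -1, 0, 0], [-1, 1, 1, -1, 0, 0],
   [1, -1, 0, 0, 0, 0], [-1, -1, 1, 0, 0, 0], [0, 1, -1, 0, 0, 0], [0, -1, -1, 1, 0, 0],
   [0, 0, 0, -1, 1, 0], [0, 0, 0, 0, -1, 1], [0, 0, 0, 0, 0, -1]]
  (by decide +kernel) (by decide +kernel) (by decide +kernel)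

theorem isBraidlessFor_E₆_five : IsBraidlessFor E₆ Set.univ 5 :=
  isBraidlessFor_of_orbit
  [[0, 0, 0, 0, 0, 1], [0, 0, 0, 0, 1, -1], [0, 0, 0, 1, -1, 0], [0, 1, 1, -1, 0, 0],
   [0, -1, 1, 0, 0, 0], [1, 1, -1, 0, 0, 0], [1, -1, -1, 1, 0, 0], [-1, 1, 0, 0, 0, 0],
   [-1, -1, 0, 1, 0, 0], [1, 0, 0, -1, 1, 0], [-1, 0, 1, -1, 1, 0], [1, 0, 0, 0, -1, 1],
   [0, 0, -1, 0, 1, 0], [-1, 0, 1, 0, -1, 1], [1, 0, 0, 0, 0, -1], [0, 0, -1, 1, -1, 1],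
   [-1, 0, 1, 0, 0, -1], [0, 1, 0, -1, 0, 1], [0, 0, -1, 1, 0, -1], [0, -1, 0, 0, 0, 1],
   [0, 1, 0, -1, 1, -1], [0, -1, 0, 0, 1, -1], [0, 1, 0, 0, -1, 0], [0, -1, 0, 1, -1, 0],
   [0, 0, 1, -1, 0, 0], [1, 0, -1, 0, 0, 0], [-1, 0, 0, 0, 0, 0]]
  (by decide +kernel) (by decide +kernel) (by decide +kernel)

theorem isBraidlessFor_E₆_iff (i : Fin 6) : IsBraidlessFor E₆ Set.univ i ↔ i = 0 ∨ i = 5 := by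
  fin_cases i
  · simpa using isBraidlessFor_E₆_zero
  · simpa using not_isBraidlessFor_of_word [1, 3, 2, 0, 4, 3, 1, 2, 3] 4 5
      (by decide) (by decide) (by decide +kernel)
  · simpa using not_isBraidlessFor_of_word [2, 0, 3, 1, 2] 3 4
      (by decide) (by decide) (by decide +kernel)
  · simpa using not_isBraidlessFor_of_word [3, 1, 2] 3 4
      (by decide) (by decide) (by decide +kernel)
  · simpa using not_isBraidlessFor_of_word [4, 3, 1, 2, 3] 4 5
      (by decide) (by decide) (by decide +kernel)
  · simpa using isBraidlessFor_E₆_five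

/-- The list consists of the 56 weights of the minuscule representation. -/
theorem isBraidlessFor_E₇_six : IsBraidlessFor E₇ Set.univ 6 :=
  isBraidlessFor_of_orbit
  [[0, 0, 0, 0, 0, 0, 1], [0, 0, 0, 0, 0, 1, -1], [0, 0, 0, 0, 1, -1, 0], [0, 0, 0, 1, -1, 0, 0],
   [0, 1, 1, -1, 0, 0, 0], [0, -1, 1, 0, 0, 0, 0], [1, 1, -1, 0, 0, 0, 0],
   [1, -1, -1, 1, 0, 0, 0], [-1, 1, 0, 0, 0, 0, 0], [-1, -1, 0, 1, 0, 0, 0],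
   [1, 0, 0, -1, 1, 0, 0], [-1, 0, 1, -1, 1, 0, 0], [1, 0, 0, 0, -1, 1, 0],
   [0, 0, -1, 0, 1, 0, 0], [-1, 0, 1, 0, -1, 1, 0], [1, 0, 0, 0, 0, -1, 1],
   [0, 0, -1, 1, -1, 1, 0], [-1, 0, 1, 0, 0, -1, 1], [1, 0, 0, 0, 0, 0, -1],
   [0, 1, 0, -1, 0, 1, 0], [0, 0, -1, 1, 0, -1, 1], [-1, 0, 1, 0, 0, 0, -1],
   [0, -1, 0, 0, 0, 1, 0], [0, 1, 0, -1, 1, -1, 1], [0, 0, -1, 1, 0, 0, -1],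
   [0, -1, 0, 0, 1, -1, 1], [0, 1, 0, 0, -1, 0, 1], [0, 1, 0, -1, 1, 0, -1],
   [0, -1, 0, 1, -1, 0, 1], [0, -1, 0, 0, 1, 0, -1], [0, 1, 0, 0, -1, 1, -1],
   [0, 0, 1, -1, 0, 0, 1], [0, -1, 0, 1, -1, 1, -1], [0, 1, 0, 0, 0, -1, 0],
   [1, 0, -1, 0, 0, 0, 1], [0, 0, 1, -1, 0, 1, -1], [0, -1, 0, 1, 0, -1, 0],
   [-1, 0, 0, 0, 0, 0, 1], [1, 0, -1, 0, 0, 1, -1], [0, 0, 1, -1, 1, -1, 0],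
   [-1, 0, 0, 0, 0, 1, -1], [1, 0, -1, 0, 1, -1, 0], [0, 0, 1, 0, -1, 0, 0],
   [-1, 0, 0, 0, 1, -1, 0], [1, 0, -1, 1, -1, 0, 0], [-1, 0, 0, 1, -1, 0, 0],
   [1, 1, 0, -1, 0, 0, 0], [-1, 1, 1, -1, 0, 0, 0], [1, -1, 0, 0, 0, 0, 0],
   [-1, -1, 1, 0, 0, 0, 0], [0, 1, -1, 0, 0, 0, 0], [0, -1, -1, 1, 0, 0, 0],
   [0, 0, 0, -1, 1, 0, 0], [0, 0, 0, 0, -1, 1, 0], [0, 0, 0, 0, 0, -1, 1], [0, 0, 0, 0, 0, 0, -1]]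
  (by decide +kernel) (by decide +kernel) (by decide +kernel)

theorem isBraidlessFor_E₇_iff (i : Fin 7) : IsBraidlessFor E₇ Set.univ i ↔ i = 6 := by
  fin_cases i
  · simpa using not_isBraidlessFor_of_word [0, 2, 3, 1, 4, 3, 2, 0, 5, 4, 3, 1, 2, 3, 4] 5 6
      (by decide) (by decide) (by decide +kernel)
  · simpa using not_isBraidlessFor_of_word [1, 3, 2, 0, 4, 3, 1, 2, 3] 4 5
      (by decide) (by decide) (by decide +kernel)
  · simpa using not_isBraidlessFor_of_word [2, 0, 3, 1, 2] 3 4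
      (by decide) (by decide) (by decide +kernel)
  · simpa using not_isBraidlessFor_of_word [3, 1, 2] 3 4
      (by decide) (by decide) (by decide +kernel)
  · simpa using not_isBraidlessFor_of_word [4, 3, 1, 2, 3] 4 5
      (by decide) (by decide) (by decide +kernel)
  · simpa using not_isBraidlessFor_of_word [5, 4, 3, 1, 2, 3, 4] 5 6
      (by decide) (by decide) (by decide +kernel)
  · simpa using isBraidlessFor_E₇_six

theorem not_isBraidlessFor_E₈ (i : Fin 8) : ¬ IsBraidlessFor E₈ Set.univ i := by
  -- The words for nodes `0` to `5` are those from E₇. Node `6`, braidless in E₇, fails here because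
  -- of the additional node `7`.
  fin_cases i
  · exact not_isBraidlessFor_of_word [0, 2, 3, 1, 4, 3, 2, 0, 5, 4, 3, 1, 2, 3, 4] 5 6
      (by decide) (by decide) (by decide +kernel)
  · exact not_isBraidlessFor_of_word [1, 3, 2, 0, 4, 3, 1, 2, 3] 4 5
      (by decide) (by decide) (by decide +kernel)
  · exact not_isBraidlessFor_of_word [2, 0, 3, 1, 2] 3 4
      (by decide) (by decide) (by decide +kernel)
  · exact not_isBraidlessFor_of_word [3, 1, 2] 3 4
      (by decide) (by decide) (by decide +kernel)
  · exact not_isBraidlessFor_of_word [4, 3, 1, 2, 3] 4 5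
      (by decide) (by decide) (by decide +kernel)
  · exact not_isBraidlessFor_of_word [5, 4, 3, 1, 2, 3, 4] 5 6
      (by decide) (by decide) (by decide +kernel)
  · exact not_isBraidlessFor_of_word [6, 5, 4, 3, 1, 2, 3, 4, 5] 6 7
      (by decide) (by decide) (by decide +kernel)
  · exact not_isBraidlessFor_of_word
      [7, 6, 5, 4, 3, 1, 2, 0, 3, 2, 4, 3, 1, 5, 4, 3, 2, 0, 6, 5, 4, 3, 1, 2, 3, 4, 5] 6 7
      (by decide) (by decide) (by decide +kernel)

theorem not_isBraidlessFor_F₄ (i : Fin 4) : ¬ IsBraidlessFor F₄ Set.univ i := by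
  fin_cases i
  · exact not_isBraidlessFor_of_word [0, 1, 2, 1, 3, 2] 0 1
      (by decide) (by decide) (by decide +kernel)
  · exact not_isBraidlessFor_of_word [1, 2] 0 1
      (by decide) (by decide) (by decide +kernel)
  · exact not_isBraidlessFor_of_word [2, 1] 2 3
      (by decide) (by decide) (by decide +kernel)
  · exact not_isBraidlessFor_of_word [3, 2, 1, 0, 2, 1] 2 3
      (by decide) (by decide) (by decide +kernel)

/-- In rank two, two positive pairings would give a strictly dominant weight, but the only dominant
weight in the orbit is `ω_i`, which has a zero pairing. -/
theorem isBraidlessFor_G₂ (i : Fin 2) : IsBraidlessFor G₂ Set.univ i := by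
  fin_cases i
  · exact isBraidlessFor_of_orbit [[1, 0], [-1, 3], [2, -3], [-2, 3], [1, -3], [-1, 0]]
      (by decide) (by decide +kernel) (by decide +kernel)
  · exact isBraidlessFor_of_orbit [[0, 1], [1, -1], [-1, 2], [1, -2], [-1, 1], [0, -1]]
      (by decide) (by decide +kernel) (by decide +kernel)

open CartanMatrix (E₆ E₇ E₈ F₄ G₂)

/-! ### Good sequences in the exceptional types -/

section Enumerations

variable {κ : Type*} {C : κ → κ → ℤ}

theorem isBraidlessFor_range_iff {n : ℕ} {A : Fin n → Fin n → ℤ} {node s : Fin n → κ}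
    (hnode : node.Injective) (hC : ∀ i j, C (node i) (node j) = A i j) (hs : s.Injective)
    (hsn : ∀ m, s m ∈ Set.range node) (i : Fin n) :
    IsBraidlessFor C (Set.range s) (node i) ↔ IsBraidlessFor A Set.univ i := by
  choose t ht using hsn
  obtain rfl : node ∘ t = s := funext ht
  have hsurj : t.Surjective := Finite.injective_iff_surjective.mp hs.of_comp
  rw [hsurj.range_comp, ← Set.image_univ, isBraidlessFor_image_iff hnode hC]

/-- Injectivity keeps the starting node out of the tail, so a labelling `f` of the other nodes
covers it. -/
theorem tail_mem_range_comp {n m : ℕ} {node : Fin (n + 1) → κ} {s : Fin (m + 1) → κ}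
    (hs : s.Injective) (hsn : ∀ k, s k ∈ Set.range node) {i : Fin (n + 1)} (h0 : s 0 = node i)
    {f : Fin m → Fin (n + 1)} (hf : ∀ q ≠ i, q ∈ Set.range f) (k : Fin m) :
    Fin.tail s k ∈ Set.range (node ∘ f) := by
  obtain ⟨q, hq⟩ := hsn k.succ
  obtain ⟨r, rfl⟩ := hf q fun h ↦ (Fin.succ_ne_zero k) (hs (by rw [h0, ← hq, h]))
  exact ⟨r, hq⟩

theorem isGoodSeq_E₆_iff {node s : Fin 6 → κ} (hnode : node.Injective)
    (hC : ∀ i j, C (node i) (node j) = E₆ i j) (hs : s.Injective)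
    (hsn : ∀ m, s m ∈ Set.range node) : IsGoodSeq C s ↔ RuleE₆ node s := by
  obtain ⟨i, hi⟩ := hsn 0
  have htail : (Fin.tail s).Injective := hs.comp (Fin.succ_injective 5)
  -- Here `f` lists the nodes other than `i` in the order that turns the remaining Cartan matrix
  -- into that of D₅.
  have key (f : Fin 5 → Fin 6) (hf : f.Injective) (hfi : ∀ q ≠ i, q ∈ Set.range f)
      (hfD : E₆.submatrix f f = CartanMatrix.D 5) :
      IsGoodSeq C (Fin.tail s) ↔ RuleD (node ∘ f) (Fin.tail s) :=
    isGoodSeq_D_iff (by omega) (hnode.comp hf)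
      (fun j l ↦ (hC _ _).trans (congrFun₂ hfD j l)) htail
      (tail_mem_range_comp hs hsn hi.symm hfi)
  have e0 : node ∘ ![5, 4, 3, 2, 1] = ![node 5, node 4, node 3, node 2, node 1] := by
    ext k; fin_cases k <;> rfl
  have e5 : node ∘ ![0, 2, 3, 1, 4] = ![node 0, node 2, node 3, node 1, node 4] := by
    ext k; fin_cases k <;> rfl
  rw [isGoodSeq_succ_iff, RuleE₆, ← hi, isBraidlessFor_range_iff hnode hC hs hsn,
    isBraidlessFor_E₆_iff, hnode.eq_iff, hnode.eq_iff, or_and_right, ← e0, ← e5]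
  refine or_congr (and_congr_right ?_) (and_congr_right ?_)
  · rintro rfl
    exact key _ (by decide) (by decide) (by decide)
  · rintro rfl
    exact key _ (by decide) (by decide) (by decide)

theorem isGoodSeq_E₇_iff {node s : Fin 7 → κ} (hnode : node.Injective)
    (hC : ∀ i j, C (node i) (node j) = E₇ i j) (hs : s.Injective)
    (hsn : ∀ m, s m ∈ Set.range node) : IsGoodSeq C s ↔ RuleE₇ node s := by
  obtain ⟨i, hi⟩ := hsn 0
  rw [isGoodSeq_succ_iff, RuleE₇, ← hi, isBraidlessFor_range_iff hnode hC hs hsn,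
    isBraidlessFor_E₇_iff, hnode.eq_iff]
  refine and_congr_right ?_
  rintro rfl
  have hE : E₇.submatrix Fin.castSucc Fin.castSucc = E₆ := by decide
  exact isGoodSeq_E₆_iff (hnode.comp (Fin.castSucc_injective 6))
    (fun j l ↦ (hC _ _).trans (congrFun₂ hE j l)) (hs.comp (Fin.succ_injective 6))
    (tail_mem_range_comp hs hsn hi.symm (f := Fin.castSucc) (by decide))

theorem not_isGoodSeq {n : ℕ} {A : Fin (n + 1) → Fin (n + 1) → ℤ}
    (hA : ∀ i, ¬ IsBraidlessFor A Set.univ i) {node s : Fin (n + 1) → κ} (hnode : node.Injective)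
    (hC : ∀ i j, C (node i) (node j) = A i j) (hs : s.Injective)
    (hsn : ∀ m, s m ∈ Set.range node) : ¬ IsGoodSeq C s := by
  obtain ⟨i, hi⟩ := hsn 0
  rw [isGoodSeq_succ_iff, ← hi, isBraidlessFor_range_iff hnode hC hs hsn]
  exact fun h ↦ hA i h.1

theorem isGoodSeq_G₂ {node s : Fin 2 → κ} (hnode : node.Injective)
    (hC : ∀ i j, C (node i) (node j) = G₂ i j) (hsn : ∀ m, s m ∈ Set.range node) :
    IsGoodSeq C s := by
  choose t ht using hsn
  obtain rfl : node ∘ t = s := funext ht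
  rw [isGoodSeq_comp_iff hnode hC]
  exact fun k ↦ (isBraidlessFor_G₂ _).mono (Set.subset_univ _)

end Enumerations

end GoodEnumeration

theorem proposition4p9 {ι K M N : Type*} [Finite ι] [Field K] [CharZero K]
    [AddCommGroup M] [Module K M] [AddCommGroup N] [Module K N]
    (P : RootPairing ι K M N) [P.IsRootSystem] [P.IsCrystallographic] (b : P.Base) :
    (∀ (n : ℕ) (e : Fin n ≃ b.support), GoodEnumeration.HasType e (CartanMatrix.A n) →
      ∀ s : Fin n ≃ b.support, GoodEnumeration.IsGood s) ∧
    (∀ n : ℕ, 2 ≤ n → ∀ e : Fin n ≃ b.support, GoodEnumeration.HasType e (CartanMatrix.B n) →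
      ∀ s : Fin n ≃ b.support, GoodEnumeration.IsGood s ↔ GoodEnumeration.RuleBC e s) ∧
    (∀ n : ℕ, 2 ≤ n → ∀ e : Fin n ≃ b.support, GoodEnumeration.HasType e (CartanMatrix.C n) →
      ∀ s : Fin n ≃ b.support, GoodEnumeration.IsGood s ↔ GoodEnumeration.RuleBC e s) ∧
    (∀ n : ℕ, 3 ≤ n → ∀ e : Fin n ≃ b.support, GoodEnumeration.HasType e (CartanMatrix.D n) →
      ∀ s : Fin n ≃ b.support, GoodEnumeration.IsGood s ↔ GoodEnumeration.RuleD e s) ∧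
    (∀ e : Fin 6 ≃ b.support, GoodEnumeration.HasType e CartanMatrix.E₆ →
      ∀ s : Fin 6 ≃ b.support, GoodEnumeration.IsGood s ↔ GoodEnumeration.RuleE₆ e s) ∧
    (∀ e : Fin 7 ≃ b.support, GoodEnumeration.HasType e CartanMatrix.E₇ →
      ∀ s : Fin 7 ≃ b.support, GoodEnumeration.IsGood s ↔ GoodEnumeration.RuleE₇ e s) ∧
    (∀ e : Fin 8 ≃ b.support, GoodEnumeration.HasType e CartanMatrix.E₈ →
      ∀ s : Fin 8 ≃ b.support, ¬ GoodEnumeration.IsGood s) ∧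
    (∀ e : Fin 4 ≃ b.support, GoodEnumeration.HasType e CartanMatrix.F₄ →
      ∀ s : Fin 4 ≃ b.support, ¬ GoodEnumeration.IsGood s) ∧
    (∀ e : Fin 2 ≃ b.support, GoodEnumeration.HasType e CartanMatrix.G₂ →
      ∀ s : Fin 2 ≃ b.support, GoodEnumeration.IsGood s) := by
  have hr {n : ℕ} (e s : Fin n ≃ b.support) (m : Fin n) : s m ∈ Set.range e := by
    simp [e.surjective.range_eq]
  refine ⟨?_, ?_, ?_, ?_, ?_, ?_, ?_, ?_, ?_⟩
  · intro n e he s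
    have hs : ⇑s = e ∘ (e.symm ∘ s) := by
      ext; simp
    rw [GoodEnumeration.isGood_iff, hs, GoodEnumeration.isGoodSeq_comp_iff e.injective he]
    exact GoodEnumeration.isGoodSeq_of_path
  · intro n hn e he s
    rw [GoodEnumeration.isGood_iff]
    exact (GoodEnumeration.isTypeBC_B n).isGoodSeq_iff (.inr rfl) (by omega) e.injective he
      s.injective (hr e s)
  · intro n hn e he s
    rw [GoodEnumeration.isGood_iff]
    exact (GoodEnumeration.isTypeBC_C n).isGoodSeq_iff (.inl rfl) (by omega) e.injective he
      s.injective (hr e s)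
  · intro n hn e he s
    rw [GoodEnumeration.isGood_iff]
    exact GoodEnumeration.isGoodSeq_D_iff hn e.injective he s.injective (hr e s)
  · intro e he s
    rw [GoodEnumeration.isGood_iff]
    exact GoodEnumeration.isGoodSeq_E₆_iff e.injective he s.injective (hr e s)
  · intro e he s
    rw [GoodEnumeration.isGood_iff]
    exact GoodEnumeration.isGoodSeq_E₇_iff e.injective he s.injective (hr e s)
  · intro e he s
    rw [GoodEnumeration.isGood_iff]
    exact GoodEnumeration.not_isGoodSeq GoodEnumeration.not_isBraidlessFor_E₈ e.injective he
      s.injective (hr e s)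
  · intro e he s
    rw [GoodEnumeration.isGood_iff]
    exact GoodEnumeration.not_isGoodSeq GoodEnumeration.not_isBraidlessFor_F₄ e.injective he
      s.injective (hr e s)
  · intro e he s
    rw [GoodEnumeration.isGood_iff]
    exact GoodEnumeration.isGoodSeq_G₂ e.injective he (hr e s)
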